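/- Let $p\ge 1$, $\mu\in\mathbb R^p$, and let $\Sigma$ be a positive definite $p\times p$ matrix. Let $\nu_1,\nu_2$ be probability distributions on $\mathbb R^p$ (not necessarily equal) with finite second moments, both with mean vector $\mu$ and covariance matrix $\Sigma$. Let $X_{1,1},X_{1,2},\dots$ be i.i.d. random vectors with distribution $\nu_1$ and $X_{2,1},X_{2,2},\dots$ i.i.d. random vectors with distribution $\nu_2$, the two sequences being independent of each other. For sample sizes $n_1,n_2$ put, for $i=1,2$, $$\bar X_i=\frac1{n_i}\sum_{k=1}^{n_i}X_{i,k},\qquad \hat\Sigma_i=\frac1{n_i}\sum_{k=1}^{n_i}(X_{i,k}-\bar X_i)(X_{i,k}-\bar X_i)^T,\qquad \hat\Sigma=\frac{n_1\hat\Sigma_1+n_2\hat\Sigma_2}{n_1+n_2-2},$$ and let $$D=\sqrt{(\bar X_1-\bar X_2)^T\hat\Sigma^{-1}(\bar X_1-\bar X_2)}$$ be the Mahalanobis distance between the two samples (with the convention $D=0$ when $\hat\Sigma$ is singular). Then, as $n_1\to\infty$ and $n_2\to\infty$ (in any manner), the probability that $\hat\Sigma$ is invertible tends to $1$, and $$\frac{n_1n_2}{n_1+n_2}\,D^2\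 \xrightarrow{d}\ \chi^2(p).$$ -/

import Mathlib

open MeasureTheory ProbabilityTheory Filter Topology
open scoped Matrix

/-- The mean vector of a sample `x` of `n` vectors in `ℝ^p` (the rows of an `n × p` array). -/
noncomputable def sampleMean {n p : ℕ} (x : Fin n → Fin p → ℝ) : Fin p → ℝ :=
  (n : ℝ)⁻¹ • ∑ i, x i

/-- The sample covariance matrix `n⁻¹ ∑ᵢ (xᵢ - x̄)(xᵢ - x̄)ᵀ`, with divisor `n`. -/
noncomputable def sampleCov {n p : ℕ} (x : Fin n → Fin p → ℝ) : Matrix (Fin p) (Fin p) ℝ :=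
  (n : ℝ)⁻¹ • ∑ i, Matrix.vecMulVec (x i - sampleMean x) (x i - sampleMean x)

/-- The pooled sample covariance matrix `(n₁ S₁ + n₂ S₂) / (n₁ + n₂ - 2)` of two samples; the
subtraction is that of the reals. -/
noncomputable def pooledCov {n₁ n₂ p : ℕ} (x : Fin n₁ → Fin p → ℝ) (y : Fin n₂ → Fin p → ℝ) :
    Matrix (Fin p) (Fin p) ℝ :=
  ((n₁ : ℝ) + (n₂ : ℝ) - 2)⁻¹ • ((n₁ : ℝ) • sampleCov x + (n₂ : ℝ) • sampleCov y)

/-- The Mahalanobis distance between two samples,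
`√((x̄ - ȳ)ᵀ S⁻¹ (x̄ - ȳ))` with `S` the pooled sample covariance matrix.
(`S⁻¹` is the zero matrix when `S` is singular.) -/
noncomputable def mahalanobisDist {n₁ n₂ p : ℕ}
    (x : Fin n₁ → Fin p → ℝ) (y : Fin n₂ → Fin p → ℝ) : ℝ :=
  √((sampleMean x - sampleMean y) ⬝ᵥ ((pooledCov x y)⁻¹ *ᵥ (sampleMean x - sampleMean y)))

/-- The law `ν` on `ℝ^p` has finite second moments, mean vector `μ` and covariance matrix `S`. -/
structure HasMeanCov {p : ℕ} (ν : Measure (Fin p → ℝ)) (μ : Fin p → ℝ)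
    (S : Matrix (Fin p) (Fin p) ℝ) : Prop where
  memLp : ∀ i, MemLp (fun v : Fin p → ℝ => v i) 2 ν
  mean : ∀ i, ∫ v, v i ∂ν = μ i
  cov : ∀ i j, cov[fun v : Fin p → ℝ => v i, fun v : Fin p → ℝ => v j; ν] = S i j

/-- The chi-squared distribution with `p` degrees of freedom: the law of `Z₁² + ⋯ + Z_p²` for
independent standard normal variables `Z₁, …, Z_p`. -/
noncomputable def chiSquared (p : ℕ) : Measure ℝ :=
  (Measure.pi fun _ : Fin p => gaussianReal 0 1).map fun z => ∑ i, z i ^ 2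

instance chiSquared_isProbabilityMeasure (p : ℕ) : IsProbabilityMeasure (chiSquared p) :=
  Measure.isProbabilityMeasure_map
    (Finset.measurable_fun_sum _ fun i _ => (measurable_pi_apply i).pow_const 2).aemeasurable

/-! With weights `√(n/(m+n))` and `-√(m/(m+n))`, the scaled mean difference is a combination of two
independent, centred and normalised sums, each asymptotically `N(0, S)` by the CLT. The squared
weights add up to 1, so the limit is again `N(0, S)`, whatever the ratio of the sample sizes. The
ratio need not converge, but compactness gives a subsequence along which it does, and since the
limit law is always the same this suffices.

By the strong law the pooled covariance tends to `S` almost surely. Slutsky's theorem, applied to a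
continuous truncation of `zᵀ M⁻¹ z`, gives the limit `zᵀ S⁻¹ z` with `z ~ N(0, S)`. Writing `z =
S^{1/2} w` with `w` standard normal turns this into `∑ wᵢ²`. The truncation is eventually inactive
because `det M → det S > 0`, which also yields invertibility. -/

lemma sampleMean_apply {p : ℕ} (x : ℕ → Fin p → ℝ) (n : ℕ) (j : Fin p) :
    sampleMean (fun k : Fin n => x k) j = (n : ℝ)⁻¹ * ∑ k ∈ Finset.range n, x k j := by
  simp [sampleMean, Finset.sum_apply, ← Fin.sum_univ_eq_sum_range (fun k => x k j)]

lemma sampleCov_apply {p : ℕ} (x : ℕ → Fin p → ℝ) (n : ℕ) (i j : Fin p) :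
    sampleCov (fun k : Fin n => x k) i j = (n : ℝ)⁻¹ * ∑ k ∈ Finset.range n, x k i * x k j
      - ((n : ℝ)⁻¹ * ∑ k ∈ Finset.range n, x k i) * ((n : ℝ)⁻¹ * ∑ k ∈ Finset.range n, x k j) := by
  rw [← sampleMean_apply, ← sampleMean_apply]
  set a := sampleMean (fun k : Fin n => x k) with ha
  have h1 : sampleCov (fun k : Fin n => x k) i j
      = (n : ℝ)⁻¹ * ∑ k ∈ Finset.range n, (x k i - a i) * (x k j - a j) := by
    simp [sampleCov, Matrix.sum_apply, Matrix.vecMulVec_apply, ← ha,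
      ← Fin.sum_univ_eq_sum_range (fun k => (x k i - a i) * (x k j - a j))]
  rw [h1]
  rcases Nat.eq_zero_or_pos n with rfl | hn
  · simp [ha, sampleMean]
  have hn' : (n : ℝ) ≠ 0 := by positivity
  have hs : ∀ j, ∑ k ∈ Finset.range n, x k j = n * a j := fun j => by
    rw [ha, sampleMean_apply]; field_simp
  have h2 : ∑ k ∈ Finset.range n, (x k i - a i) * (x k j - a j)
      = ∑ k ∈ Finset.range n, x k i * x k j - n * (a i * a j) := by
    calc _ = ∑ k ∈ Finset.range n, (x k i * x k j - x k i * a j - a i * x k j + a i * a j) :=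
          Finset.sum_congr rfl fun k _ => by ring
      _ = _ := by
          rw [Finset.sum_add_distrib, Finset.sum_sub_distrib, Finset.sum_sub_distrib,
            ← Finset.sum_mul, ← Finset.mul_sum, hs, hs]
          simp
          ring
  rw [h2]
  field_simp

/-! ### One sample: strong law, and the CLT for linear functionals. -/

section Sample

variable {Ω : Type*} [MeasurableSpace Ω] {P : Measure Ω} {p : ℕ} {μ : Fin p → ℝ}
  {S : Matrix (Fin p) (Fin p) ℝ} {ν : Measure (Fin p → ℝ)} {X : ℕ → Ω → Fin p → ℝ}

lemma identDistrib_of_hasLaw (hlaw : ∀ k, HasLaw (X k) ν P) (k : ℕ) :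
    IdentDistrib (X k) (X 0) P P :=
  ⟨(hlaw k).aemeasurable, (hlaw 0).aemeasurable, by rw [(hlaw k).map_eq, (hlaw 0).map_eq]⟩

lemma ae_tendsto_average_of_hasLaw (hlaw : ∀ k, HasLaw (X k) ν P) (hind : iIndepFun X P)
    {f : (Fin p → ℝ) → ℝ} (hf : Measurable f) (hint : Integrable f ν) :
    ∀ᵐ ω ∂P, Tendsto (fun n : ℕ => (n : ℝ)⁻¹ * ∑ k ∈ Finset.range n, f (X k ω)) atTop
      (𝓝 (∫ v, f v ∂ν)) := by
  have h := strong_law_ae (μ := P) (fun k ω => f (X k ω)) ?_ ?_ ?_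
  · have h0 : ∫ ω, f (X 0 ω) ∂P = ∫ v, f v ∂ν :=
      (hlaw 0).integral_comp hf.aestronglyMeasurable
    rw [h0] at h
    simpa using h
  · rw [← (hlaw 0).map_eq] at hint
    exact hint.comp_aemeasurable (hlaw 0).aemeasurable
  · intro i j hij
    exact (hind.indepFun hij).comp hf hf
  · intro k
    exact (identDistrib_of_hasLaw hlaw k).comp hf

lemma HasMeanCov.ae_tendsto_sampleCov [IsProbabilityMeasure ν] (hν : HasMeanCov ν μ S)
    (hlaw : ∀ k, HasLaw (X k) ν P) (hind : iIndepFun X P) :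
    ∀ᵐ ω ∂P, ∀ i j, Tendsto (fun n : ℕ => sampleCov (fun k : Fin n => X k ω) i j) atTop
      (𝓝 (S i j)) := by
  rw [ae_all_iff]; intro i
  rw [ae_all_iff]; intro j
  have hmean : ∀ i, ∀ᵐ ω ∂P, Tendsto (fun n : ℕ => (n : ℝ)⁻¹ * ∑ k ∈ Finset.range n, X k ω i)
      atTop (𝓝 (μ i)) := fun i => by
    rw [← hν.mean i]
    exact ae_tendsto_average_of_hasLaw hlaw hind (measurable_pi_apply i)
      ((hν.memLp i).integrable (by norm_num))
  have hprod := ae_tendsto_average_of_hasLaw hlaw hind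
    (f := fun v => v i * v j) (by fun_prop) ((hν.memLp i).integrable_mul (hν.memLp j))
  filter_upwards [hmean i, hmean j, hprod] with ω hi hj hij
  have hc := covariance_eq_sub (hν.memLp i) (hν.memLp j)
  rw [hν.cov, hν.mean, hν.mean] at hc
  simp only [Pi.mul_apply] at hc
  rw [hc]
  simp_rw [sampleCov_apply (fun k => X k ω)]
  exact hij.sub (hi.mul hj)

lemma HasMeanCov.variance_dotProduct [IsProbabilityMeasure ν] (hν : HasMeanCov ν μ S)
    (t : Fin p → ℝ) : Var[fun v => v ⬝ᵥ t; ν] = t ⬝ᵥ S *ᵥ t := by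
  rw [← covariance_self (Measurable.aemeasurable (by unfold dotProduct; fun_prop))]
  simp only [dotProduct, Matrix.mulVec]
  rw [covariance_fun_sum_fun_sum (fun i => (hν.memLp i).mul_const _)
    (fun i => (hν.memLp i).mul_const _)]
  refine Finset.sum_congr rfl fun i _ => ?_
  rw [Finset.mul_sum]
  refine Finset.sum_congr rfl fun j _ => ?_
  rw [covariance_mul_const_left, covariance_mul_const_right, hν.cov]
  ring

lemma HasMeanCov.integral_dotProduct [IsProbabilityMeasure ν] (hν : HasMeanCov ν μ S)
    (t : Fin p → ℝ) : ∫ v, v ⬝ᵥ t ∂ν = μ ⬝ᵥ t := by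
  simp only [dotProduct]
  rw [integral_finsetSum _ fun i _ => ((hν.memLp i).integrable (by norm_num)).mul_const _]
  simp [integral_mul_const, hν.mean]

lemma HasMeanCov.memLp_dotProduct (hν : HasMeanCov ν μ S) (t : Fin p → ℝ) :
    MemLp (fun v => v ⬝ᵥ t) 2 ν := by
  simp only [dotProduct]
  exact memLp_finsetSum _ fun i _ => (hν.memLp i).mul_const _

lemma HasMeanCov.tendstoInDistribution_dotProduct [IsProbabilityMeasure P]
    (hν : HasMeanCov ν μ S)
    (hlaw : ∀ k, HasLaw (X k) ν P) (hind : iIndepFun X P) (t : Fin p → ℝ) :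
    TendstoInDistribution
      (fun (n : ℕ) ω => (√n)⁻¹ * (∑ k ∈ Finset.range n, X k ω ⬝ᵥ t - n * (μ ⬝ᵥ t))) atTop id
      (fun _ => P) (gaussianReal 0 (t ⬝ᵥ S *ᵥ t).toNNReal) := by
  have : IsProbabilityMeasure ν := (hlaw 0).isProbabilityMeasure_iff.1 inferInstance
  have hm : Measurable fun v : Fin p → ℝ => v ⬝ᵥ t := by unfold dotProduct; fun_prop
  have hvar : Var[fun ω => X 0 ω ⬝ᵥ t; P] = t ⬝ᵥ S *ᵥ t := by
    rw [← hν.variance_dotProduct, ← (hlaw 0).map_eq,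
      variance_map hm.aemeasurable (hlaw 0).aemeasurable]
    rfl
  have hmean : ∫ ω, X 0 ω ⬝ᵥ t ∂P = μ ⬝ᵥ t := by
    rw [← hν.integral_dotProduct]
    exact (hlaw 0).integral_comp hm.aestronglyMeasurable
  have h := tendstoInDistribution_inv_sqrt_mul_sum_sub (P := P)
    (P' := gaussianReal 0 (t ⬝ᵥ S *ᵥ t).toNNReal) (X := fun k ω => X k ω ⬝ᵥ t) (Y := id)
    (by rw [hvar]; exact HasLaw.id) ?_ (hind.comp (fun _ v => v ⬝ᵥ t) fun _ => hm)
    fun k => (identDistrib_of_hasLaw hlaw k).comp hm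
  · rwa [hmean] at h
  · have := hν.memLp_dotProduct t
    rw [← (hlaw 0).map_eq] at this
    exact this.comp_of_map (hlaw 0).aemeasurable

lemma tendsto_charFun_mul_of_tendstoInDistribution_gaussianReal [IsProbabilityMeasure P]
    {U : ℕ → Ω → ℝ} {v : NNReal} (hU : TendstoInDistribution U atTop id (fun _ => P)
      (gaussianReal 0 v)) {a : ℕ → ℝ} {a₀ : ℝ} (ha : Tendsto a atTop (𝓝 a₀)) :
    Tendsto (fun n => charFun (P.map fun ω => a n * U n ω) 1) atTop
      (𝓝 (Complex.exp (-(a₀ ^ 2 * v / 2)))) := by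
  -- Slutsky, with the deterministic factors `a n` viewed as constant random variables.
  have h := hU.continuous_comp_prodMk_of_tendstoInMeasure_const
    (g := fun q : ℝ × ℝ => q.2 * q.1) (by fun_prop) (Y := fun n _ => a n) (c := a₀)
    (tendstoInMeasure_of_tendsto_ae (fun n => by fun_prop) (ae_of_all _ fun _ => ha))
    (fun n => by fun_prop)
  have h2 := ProbabilityMeasure.tendsto_iff_tendsto_charFun.1 h.tendsto 1
  convert! h2 using 2
  simp only [ProbabilityMeasure.coe_mk, id]
  rw [gaussianReal_map_const_mul, charFun_gaussianReal]
  congr 1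
  simp

end Sample

/-! ### The quadratic form and its Gaussian limit law. -/

/-- The quadratic form `zᵀ M⁻¹ z`, truncated so as to be continuous in `(z, M)`: the determinant in
the denominator is bounded below by `c`. -/
noncomputable def truncatedQuadForm {p : ℕ} (c : ℝ)
    (q : EuclideanSpace ℝ (Fin p) × (Fin p → Fin p → ℝ)) : ℝ :=
  max ((q.1.ofLp ⬝ᵥ (Matrix.adjugate (Matrix.of q.2) *ᵥ q.1.ofLp)) / max (Matrix.of q.2).det c) 0

lemma continuous_truncatedQuadForm {p : ℕ} {c : ℝ} (hc : 0 < c) :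
    Continuous (truncatedQuadForm (p := p) c) := by
  unfold truncatedQuadForm
  have hM : Continuous fun q : EuclideanSpace ℝ (Fin p) × (Fin p → Fin p → ℝ) =>
      Matrix.of q.2 := continuous_snd
  have hz : Continuous fun q : EuclideanSpace ℝ (Fin p) × (Fin p → Fin p → ℝ) => q.1.ofLp := by
    fun_prop
  refine Continuous.max (Continuous.div ?_ ?_ fun q => ?_) continuous_const
  · exact hz.dotProduct (hM.matrix_adjugate.matrix_mulVec hz)
  · exact hM.matrix_det.max continuous_const
  · exact (lt_max_of_lt_right hc).ne'

/-- Holds for singular `M` too: both sides are then 0 by convention. -/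
lemma dotProduct_inv_mulVec {p : ℕ} (M : Matrix (Fin p) (Fin p) ℝ) (z : Fin p → ℝ) :
    z ⬝ᵥ (M⁻¹ *ᵥ z) = (z ⬝ᵥ (M.adjugate *ᵥ z)) / M.det := by
  rw [Matrix.inv_def, Matrix.smul_mulVec, dotProduct_smul, Ring.inverse_eq_inv, smul_eq_mul]
  ring

lemma truncatedQuadForm_of_le_det {p : ℕ} {c : ℝ} {M : Matrix (Fin p) (Fin p) ℝ}
    (h : c ≤ M.det) (z : EuclideanSpace ℝ (Fin p)) :
    truncatedQuadForm c (z, fun i j => M i j) = max (z.ofLp ⬝ᵥ (M⁻¹ *ᵥ z.ofLp)) 0 := by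
  have : Matrix.of (fun i j => M i j) = M := rfl
  simp only [truncatedQuadForm, this, max_eq_left h, dotProduct_inv_mulVec]

open scoped MatrixOrder in
lemma dotProduct_inv_mulVec_sqrt {p : ℕ} {S : Matrix (Fin p) (Fin p) ℝ} (hS : S.PosDef)
    (z : Fin p → ℝ) :
    (CFC.sqrt S *ᵥ z) ⬝ᵥ (S⁻¹ *ᵥ (CFC.sqrt S *ᵥ z)) = ∑ i, z i ^ 2 := by
  have hR : CFC.sqrt S * CFC.sqrt S = S := by
    exact CFC.sqrt_mul_sqrt_self S hS.posSemidef.nonneg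
  have hT : (CFC.sqrt S)ᵀ = CFC.sqrt S := by
    have h : (CFC.sqrt S).PosSemidef := Matrix.nonneg_iff_posSemidef.1 (CFC.sqrt_nonneg S)
    simpa using h.isHermitian.eq
  have hdet : IsUnit (CFC.sqrt S).det := by
    have h := hS.det_pos.ne'
    rw [← hR, Matrix.det_mul] at h
    exact isUnit_iff_ne_zero.2 (left_ne_zero_of_mul h)
  generalize CFC.sqrt S = R at *
  subst hR
  rw [Matrix.mulVec_mulVec, Matrix.mul_inv_rev, Matrix.mul_assoc, Matrix.nonsing_inv_mul _ hdet,
    Matrix.mul_one, ← Matrix.vecMul_transpose, hT, ← Matrix.dotProduct_mulVec, Matrix.mulVec_mulVec,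
    Matrix.mul_nonsing_inv _ hdet, Matrix.one_mulVec]
  simp [dotProduct, sq]

lemma map_multivariateGaussian_eq_chiSquared {p : ℕ} {S : Matrix (Fin p) (Fin p) ℝ}
    (hS : S.PosDef) {g : EuclideanSpace ℝ (Fin p) → ℝ} (hg : Measurable g)
    (h : ∀ z, g z = max (z.ofLp ⬝ᵥ (S⁻¹ *ᵥ z.ofLp)) 0) :
    (multivariateGaussian 0 S).map g = chiSquared p := by
  rw [multivariateGaussian, ← map_pi_eq_stdGaussian, Measure.map_map hg (by fun_prop),
    Measure.map_map (hg.comp (by fun_prop)) (by fun_prop), chiSquared]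
  congr 1
  ext z
  simp only [Function.comp_apply, h, zero_add, Matrix.ofLp_toEuclideanCLM,
    dotProduct_inv_mulVec_sqrt hS]
  exact max_eq_left (Finset.sum_nonneg fun i _ => sq_nonneg _)

/-! ### Deterministic facts about the pooled covariance and the scaled mean difference. -/

lemma tendsto_pooledCov {p : ℕ} {S : Matrix (Fin p) (Fin p) ℝ} {x y : ℕ → Fin p → ℝ}
    {i j : Fin p}
    (hx : Tendsto (fun n : ℕ => sampleCov (fun k : Fin n => x k) i j) atTop (𝓝 (S i j)))
    (hy : Tendsto (fun n : ℕ => sampleCov (fun k : Fin n => y k) i j) atTop (𝓝 (S i j)))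
    {m n : ℕ → ℕ} (hm : Tendsto m atTop atTop) (hn : Tendsto n atTop atTop) :
    Tendsto (fun k => pooledCov (fun l : Fin (m k) => x l) (fun l : Fin (n k) => y l) i j) atTop
      (𝓝 (S i j)) := by
  set f := fun k => sampleCov (fun l : Fin (m k) => x l) i j - S i j with hf
  set g := fun k => sampleCov (fun l : Fin (n k) => y l) i j - S i j with hg
  have hf0 : Tendsto f atTop (𝓝 0) := by simpa using (hx.comp hm).sub_const (S i j)
  have hg0 : Tendsto g atTop (𝓝 0) := by simpa using (hy.comp hn).sub_const (S i j)
  have hm' : Tendsto (fun k => (m k : ℝ)) atTop atTop := tendsto_natCast_atTop_atTop.comp hm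
  have hn' : Tendsto (fun k => (n k : ℝ)) atTop atTop := tendsto_natCast_atTop_atTop.comp hn
  have hinv : Tendsto (fun k => ((m k : ℝ) + n k - 2)⁻¹) atTop (𝓝 0) :=
    tendsto_inv_atTop_zero.comp <| by
      simpa [sub_eq_add_neg] using
        tendsto_atTop_add_const_right _ (-2 : ℝ) (hm'.atTop_add_atTop hn')
  rw [tendsto_iff_norm_sub_tendsto_zero]
  refine squeeze_zero' (g := fun k => 2 * |f k| + 2 * |g k|
    + 2 * ((m k : ℝ) + n k - 2)⁻¹ * |S i j|) (Eventually.of_forall fun _ => norm_nonneg _) ?_ ?_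
  · filter_upwards [hm.eventually_ge_atTop 4, hn.eventually_ge_atTop 4] with k h1 h2
    have h1' : (4 : ℝ) ≤ m k := by exact_mod_cast h1
    have h2' : (4 : ℝ) ≤ n k := by exact_mod_cast h2
    have hN : 0 < (m k : ℝ) + n k - 2 := by linarith
    -- The weights sum to `(m+n)/(m+n-2)`, not 1; the excess `2/(m+n-2)` gives the last term. Each
    -- weight stays below 2, so convergence of the ratio is not needed.
    have e : pooledCov (fun l : Fin (m k) => x l) (fun l : Fin (n k) => y l) i j - S i j
        = (m k / ((m k : ℝ) + n k - 2)) * f k + (n k / ((m k : ℝ) + n k - 2)) * g k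
          + 2 * ((m k : ℝ) + n k - 2)⁻¹ * S i j := by
      simp only [pooledCov, Matrix.smul_apply, Matrix.add_apply, smul_eq_mul, hf, hg]
      field_simp
      ring
    have b1 : (m k : ℝ) / ((m k : ℝ) + n k - 2) ≤ 2 := by rw [div_le_iff₀ hN]; linarith
    have b2 : (n k : ℝ) / ((m k : ℝ) + n k - 2) ≤ 2 := by rw [div_le_iff₀ hN]; linarith
    rw [e, Real.norm_eq_abs]
    refine (abs_add_three _ _ _).trans ?_
    rw [abs_mul, abs_mul, abs_mul, abs_of_nonneg (div_nonneg (Nat.cast_nonneg (m k)) hN.le),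
      abs_of_nonneg (div_nonneg (Nat.cast_nonneg (n k)) hN.le),
      abs_of_nonneg (mul_nonneg zero_le_two (inv_nonneg.2 hN.le))]
    gcongr
  · simpa using ((hf0.abs.const_mul 2).add (hg0.abs.const_mul 2)).add
      ((hinv.const_mul 2).mul_const |S i j|)

/-- The difference of the sample means, scaled by `√(m n / (m + n))`. -/
noncomputable def scaledMeanDiff {m n p : ℕ} (x : Fin m → Fin p → ℝ) (y : Fin n → Fin p → ℝ) :
    EuclideanSpace ℝ (Fin p) :=
  WithLp.toLp 2 (√((m : ℝ) * n / ((m : ℝ) + n)) • (sampleMean x - sampleMean y))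

/-- The `max` with 0 reflects `√` being 0 on negatives; it avoids any positivity claim about the
pooled covariance. -/
lemma mul_mahalanobisDist_sq {m n p : ℕ} (x : Fin m → Fin p → ℝ) (y : Fin n → Fin p → ℝ) :
    ((m : ℝ) * n / ((m : ℝ) + n)) * mahalanobisDist x y ^ 2
      = max ((scaledMeanDiff x y).ofLp ⬝ᵥ ((pooledCov x y)⁻¹ *ᵥ (scaledMeanDiff x y).ofLp)) 0 := by
  have hc : 0 ≤ (m : ℝ) * n / ((m : ℝ) + n) := by positivity
  rw [mahalanobisDist, Real.sq_sqrt', mul_max_of_nonneg _ _ hc, mul_zero]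
  simp only [scaledMeanDiff, Matrix.mulVec_smul, dotProduct_smul, smul_dotProduct, smul_eq_mul]
  rw [← mul_assoc, Real.mul_self_sqrt hc]

lemma sampleMean_dotProduct {p : ℕ} (x : ℕ → Fin p → ℝ) (n : ℕ) (t : Fin p → ℝ) :
    sampleMean (fun k : Fin n => x k) ⬝ᵥ t = (n : ℝ)⁻¹ * ∑ k ∈ Finset.range n, x k ⬝ᵥ t := by
  simp [sampleMean, sum_dotProduct, ← Fin.sum_univ_eq_sum_range (fun k => x k ⬝ᵥ t)]

/-- Any common centring `c` cancels in the difference; it will be the shared mean `μ ⬝ᵥ t`. -/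
lemma scaledMeanDiff_dotProduct {p m n : ℕ} (hm : 0 < m) (hn : 0 < n) (x y : ℕ → Fin p → ℝ)
    (t : Fin p → ℝ) (c : ℝ) :
    (scaledMeanDiff (fun k : Fin m => x k) (fun k : Fin n => y k)).ofLp ⬝ᵥ t
      = √((n : ℝ) / ((m : ℝ) + n)) * ((√m)⁻¹ * (∑ k ∈ Finset.range m, x k ⬝ᵥ t - m * c))
        + -√((m : ℝ) / ((m : ℝ) + n)) * ((√n)⁻¹ * (∑ k ∈ Finset.range n, y k ⬝ᵥ t - n * c)) := by
  have hm' : (0 : ℝ) < m := by exact_mod_cast hm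
  have hn' : (0 : ℝ) < n := by exact_mod_cast hn
  simp only [scaledMeanDiff, smul_dotProduct, sub_dotProduct, sampleMean_dotProduct, smul_eq_mul]
  have e1 : √((m : ℝ) * n / ((m : ℝ) + n)) = √((n : ℝ) / ((m : ℝ) + n)) * (√m)⁻¹ * m := by
    have : (√(m : ℝ))⁻¹ * m = √m := by
      rw [inv_mul_eq_div, Real.div_sqrt]
    rw [mul_assoc, this, ← Real.sqrt_mul (by positivity)]
    congr 1; ring
  have e2 : √((m : ℝ) * n / ((m : ℝ) + n)) = √((m : ℝ) / ((m : ℝ) + n)) * (√n)⁻¹ * n := by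
    have : (√(n : ℝ))⁻¹ * n = √n := by
      rw [inv_mul_eq_div, Real.div_sqrt]
    rw [mul_assoc, this, ← Real.sqrt_mul (by positivity)]
    congr 1; ring
  generalize ∑ k ∈ Finset.range m, x k ⬝ᵥ t = A
  generalize ∑ k ∈ Finset.range n, y k ⬝ᵥ t = B
  have h1 : √((m : ℝ) * n / ((m : ℝ) + n)) * ((m : ℝ)⁻¹ * A - c)
      = √((n : ℝ) / ((m : ℝ) + n)) * ((√m)⁻¹ * (A - m * c)) := by
    rw [e1]; field_simp
  have h2 : √((m : ℝ) * n / ((m : ℝ) + n)) * ((n : ℝ)⁻¹ * B - c)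
      = √((m : ℝ) / ((m : ℝ) + n)) * ((√n)⁻¹ * (B - n * c)) := by
    rw [e2]; field_simp
  linear_combination h1 - h2

lemma charFun_map_eq_charFun_map_dotProduct {Ω : Type*} [MeasurableSpace Ω] {P : Measure Ω} {p : ℕ}
    {D : Ω → EuclideanSpace ℝ (Fin p)} (hD : AEMeasurable D P) (t : EuclideanSpace ℝ (Fin p)) :
    charFun (P.map D) t = charFun (P.map fun ω => (D ω).ofLp ⬝ᵥ t.ofLp) 1 := by
  have hm : AEMeasurable (fun ω => (D ω).ofLp ⬝ᵥ t.ofLp) P := by unfold dotProduct; fun_prop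
  rw [charFun_apply, charFun_apply_real, integral_map hD (by fun_prop),
    integral_map hm (by fun_prop)]
  simp [EuclideanSpace.inner_eq_star_dotProduct, dotProduct_comm]

/-! ### Two independent samples: measurability and limits along sequences of sample sizes. -/

section TwoSamples

variable {Ω : Type*} [MeasurableSpace Ω] {P : Measure Ω} {p : ℕ} {X Y : ℕ → Ω → Fin p → ℝ}

lemma aemeasurable_sampleMean (hX : ∀ k, AEMeasurable (X k) P) (n : ℕ) :
    AEMeasurable (fun ω => sampleMean (fun k : Fin n => X k ω)) P := by
  unfold sampleMean
  fun_prop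

lemma aemeasurable_sampleCov (hX : ∀ k, AEMeasurable (X k) P) (n : ℕ) (i j : Fin p) :
    AEMeasurable (fun ω => sampleCov (fun k : Fin n => X k ω) i j) P := by
  rw [funext fun ω => sampleCov_apply (fun k => X k ω) n i j]
  fun_prop

lemma aemeasurable_pooledCov (hX : ∀ k, AEMeasurable (X k) P) (hY : ∀ k, AEMeasurable (Y k) P)
    (m n : ℕ) :
    AEMeasurable (fun ω i j => pooledCov (fun k : Fin m => X k ω) (fun k : Fin n => Y k ω) i j)
      P := by
  refine aemeasurable_pi_lambda _ fun i => aemeasurable_pi_lambda _ fun j => ?_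
  exact (((aemeasurable_sampleCov hX m i j).const_mul _).add
    ((aemeasurable_sampleCov hY n i j).const_mul _)).const_mul _

lemma aemeasurable_scaledMeanDiff (hX : ∀ k, AEMeasurable (X k) P)
    (hY : ∀ k, AEMeasurable (Y k) P) (m n : ℕ) :
    AEMeasurable (fun ω => scaledMeanDiff (fun k : Fin m => X k ω) (fun k : Fin n => Y k ω)) P := by
  have h1 := aemeasurable_sampleMean hX m
  have h2 := aemeasurable_sampleMean hY n
  unfold scaledMeanDiff
  fun_prop

lemma aemeasurable_mul_mahalanobisDist_sq (hX : ∀ k, AEMeasurable (X k) P)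
    (hY : ∀ k, AEMeasurable (Y k) P) (m n : ℕ) :
    AEMeasurable (fun ω => ((m : ℝ) * n / ((m : ℝ) + n)) *
      mahalanobisDist (fun k : Fin m => X k ω) (fun k : Fin n => Y k ω) ^ 2) P := by
  have hg : Measurable fun q : EuclideanSpace ℝ (Fin p) × (Fin p → Fin p → ℝ) =>
      max ((q.1.ofLp ⬝ᵥ (Matrix.adjugate (Matrix.of q.2) *ᵥ q.1.ofLp)) / (Matrix.of q.2).det)
        0 := by
    have hM : Continuous fun q : EuclideanSpace ℝ (Fin p) × (Fin p → Fin p → ℝ) =>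
        Matrix.of q.2 := continuous_snd
    have hz : Continuous fun q : EuclideanSpace ℝ (Fin p) × (Fin p → Fin p → ℝ) => q.1.ofLp := by
      fun_prop
    exact ((hz.dotProduct (hM.matrix_adjugate.matrix_mulVec hz)).measurable.div
      hM.matrix_det.measurable).max measurable_const
  refine (hg.comp_aemeasurable ((aemeasurable_scaledMeanDiff hX hY m n).prodMk
    (aemeasurable_pooledCov hX hY m n))).congr (ae_of_all _ fun ω => ?_)
  have h := mul_mahalanobisDist_sq (fun k : Fin m => X k ω) (fun k : Fin n => Y k ω)
  rw [dotProduct_inv_mulVec] at h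
  exact h.symm

variable [IsProbabilityMeasure P] {μ : Fin p → ℝ} {S : Matrix (Fin p) (Fin p) ℝ}
  {ν₁ ν₂ : Measure (Fin p → ℝ)}

/-- Lévy continuity reduces this to characteristic functions, which factor by independence. The
exponents carry `a²` and `1 - a²`, so `a` drops out of the limit. -/
lemma tendstoInDistribution_scaledMeanDiff (hS : S.PosSemidef) (hν₁ : HasMeanCov ν₁ μ S)
    (hν₂ : HasMeanCov ν₂ μ S) (hlaw₁ : ∀ k, HasLaw (X k) ν₁ P) (hlaw₂ : ∀ k, HasLaw (Y k) ν₂ P)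
    (hind₁ : iIndepFun X P) (hind₂ : iIndepFun Y P)
    (hind : IndepFun (fun ω k => X k ω) (fun ω k => Y k ω) P) {m n : ℕ → ℕ}
    (hm : Tendsto m atTop atTop) (hn : Tendsto n atTop atTop) {a : ℝ}
    (ha : Tendsto (fun k => √((n k : ℝ) / ((m k : ℝ) + n k))) atTop (𝓝 a)) :
    TendstoInDistribution
      (fun k ω => scaledMeanDiff (fun l : Fin (m k) => X l ω) (fun l : Fin (n k) => Y l ω))
      atTop id (fun _ => P) (multivariateGaussian 0 S) := by
  have hD := fun k => aemeasurable_scaledMeanDiff (fun l => (hlaw₁ l).aemeasurable)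
    (fun l => (hlaw₂ l).aemeasurable) (m k) (n k)
  refine ⟨hD, by fun_prop, ProbabilityMeasure.tendsto_iff_tendsto_charFun.2 fun t => ?_⟩
  simp only [ProbabilityMeasure.coe_mk, Measure.map_id]
  have hpos : ∀ᶠ k in atTop, 0 < m k ∧ 0 < n k :=
    (hm.eventually_gt_atTop 0).and (hn.eventually_gt_atTop 0)
  have hsq : ∀ᶠ k in atTop, √((n k : ℝ) / ((m k : ℝ) + n k)) ^ 2
      + √((m k : ℝ) / ((m k : ℝ) + n k)) ^ 2 = 1 := by
    filter_upwards [hpos] with k hk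
    have h1 : (0 : ℝ) < m k := by exact_mod_cast hk.1
    have h2 : (0 : ℝ) < n k := by exact_mod_cast hk.2
    rw [Real.sq_sqrt (by positivity), Real.sq_sqrt (by positivity)]
    field_simp
    ring
  have hb : Tendsto (fun k => -√((m k : ℝ) / ((m k : ℝ) + n k))) atTop (𝓝 (-√(1 - a ^ 2))) := by
    refine ((tendsto_const_nhds.sub (ha.pow 2)).sqrt.congr' ?_).neg
    filter_upwards [hsq] with k hk
    rw [← hk, add_sub_cancel_left, Real.sqrt_sq (Real.sqrt_nonneg _)]
  have hab : a ^ 2 + (-√(1 - a ^ 2)) ^ 2 = 1 := by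
    refine tendsto_nhds_unique ((ha.pow 2).add (hb.pow 2)) ?_
    refine tendsto_const_nhds.congr' ?_
    filter_upwards [hsq] with k hk
    rw [neg_sq, hk]
  -- Reindexes the CLT along arbitrary sample sizes tending to infinity, not necessarily monotone.
  have hU := fun (s : ℕ → ℕ) (hs : Tendsto s atTop atTop) (Z : ℕ → Ω → Fin p → ℝ)
    (h : TendstoInDistribution (fun (n : ℕ) ω => (√n)⁻¹ *
      (∑ k ∈ Finset.range n, Z k ω ⬝ᵥ t.ofLp - n * (μ ⬝ᵥ t.ofLp))) atTop id (fun _ => P)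
      (gaussianReal 0 (t.ofLp ⬝ᵥ S *ᵥ t.ofLp).toNNReal)) =>
    (⟨fun k => h.forall_aemeasurable (s k), h.aemeasurable_limit, h.tendsto.comp hs⟩ :
      TendstoInDistribution (fun (k : ℕ) ω => (√(s k))⁻¹ *
      (∑ l ∈ Finset.range (s k), Z l ω ⬝ᵥ t.ofLp - s k * (μ ⬝ᵥ t.ofLp))) atTop id (fun _ => P)
      (gaussianReal 0 (t.ofLp ⬝ᵥ S *ᵥ t.ofLp).toNNReal))
  have hU₁ := hU m hm X (hν₁.tendstoInDistribution_dotProduct hlaw₁ hind₁ t.ofLp)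
  have hU₂ := hU n hn Y (hν₂.tendstoInDistribution_dotProduct hlaw₂ hind₂ t.ofLp)
  have h1 := tendsto_charFun_mul_of_tendstoInDistribution_gaussianReal hU₁ ha
  have h2 := tendsto_charFun_mul_of_tendstoInDistribution_gaussianReal hU₂ hb
  have hlim := h1.mul h2
  rw [charFun_multivariateGaussian hS]
  have hq : 0 ≤ t.ofLp ⬝ᵥ S *ᵥ t.ofLp := by simpa using hS.dotProduct_mulVec_nonneg t.ofLp
  have hval : Complex.exp (-((a : ℂ) ^ 2 * ((t.ofLp ⬝ᵥ S *ᵥ t.ofLp).toNNReal : ℝ) / 2))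
      * Complex.exp (-(((-√(1 - a ^ 2) : ℝ) : ℂ) ^ 2
        * ((t.ofLp ⬝ᵥ S *ᵥ t.ofLp).toNNReal : ℝ) / 2))
      = Complex.exp ((inner ℝ t (0 : EuclideanSpace ℝ (Fin p)) : ℝ) * Complex.I
        - (t.ofLp ⬝ᵥ S *ᵥ t.ofLp : ℝ) / 2) := by
    rw [← Complex.exp_add, Real.coe_toNNReal _ hq, inner_zero_right, Complex.ofReal_zero]
    congr 1
    have hab' : (a : ℂ) ^ 2 + ((-√(1 - a ^ 2) : ℝ) : ℂ) ^ 2 = 1 := by exact_mod_cast hab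
    linear_combination (-(t.ofLp ⬝ᵥ S *ᵥ t.ofLp : ℝ) / 2 : ℂ) * hab'
  refine (hval ▸ hlim).congr' ?_
  filter_upwards [hpos] with k hk
  rw [charFun_map_eq_charFun_map_dotProduct (hD k)]
  rw [funext fun ω => scaledMeanDiff_dotProduct hk.1 hk.2 (fun l => X l ω) (fun l => Y l ω) t.ofLp
    (μ ⬝ᵥ t.ofLp), IndepFun.charFun_map_fun_add_eq_mul ((hU₁.forall_aemeasurable k).const_mul _)
    ((hU₂.forall_aemeasurable k).const_mul _), Pi.mul_apply]
  have hφ : ∀ (c : ℝ) (s : ℕ), Measurable fun z : ℕ → Fin p → ℝ => c * ((√s)⁻¹ *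
      (∑ l ∈ Finset.range s, z l ⬝ᵥ t.ofLp - s * (μ ⬝ᵥ t.ofLp))) := by
    intro c s
    unfold dotProduct
    fun_prop
  exact hind.comp (hφ _ _) (hφ _ _)

lemma ae_tendsto_pooledCov (hν₁ : HasMeanCov ν₁ μ S)
    (hν₂ : HasMeanCov ν₂ μ S) (hlaw₁ : ∀ k, HasLaw (X k) ν₁ P) (hlaw₂ : ∀ k, HasLaw (Y k) ν₂ P)
    (hind₁ : iIndepFun X P) (hind₂ : iIndepFun Y P) {m n : ℕ → ℕ}
    (hm : Tendsto m atTop atTop) (hn : Tendsto n atTop atTop) :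
    ∀ᵐ ω ∂P, Tendsto
      (fun k i j => pooledCov (fun l : Fin (m k) => X l ω) (fun l : Fin (n k) => Y l ω) i j) atTop
      (𝓝 fun i j => S i j) := by
  have : IsProbabilityMeasure ν₁ := (hlaw₁ 0).isProbabilityMeasure_iff.1 inferInstance
  have : IsProbabilityMeasure ν₂ := (hlaw₂ 0).isProbabilityMeasure_iff.1 inferInstance
  filter_upwards [hν₁.ae_tendsto_sampleCov hlaw₁ hind₁, hν₂.ae_tendsto_sampleCov hlaw₂ hind₂]
    with ω h1 h2
  refine tendsto_pi_nhds.2 fun i => tendsto_pi_nhds.2 fun j => ?_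
  exact tendsto_pooledCov (x := fun k => X k ω) (y := fun k => Y k ω) (h1 i j) (h2 i j) hm hn

lemma ae_tendsto_det_pooledCov (hν₁ : HasMeanCov ν₁ μ S)
    (hν₂ : HasMeanCov ν₂ μ S) (hlaw₁ : ∀ k, HasLaw (X k) ν₁ P) (hlaw₂ : ∀ k, HasLaw (Y k) ν₂ P)
    (hind₁ : iIndepFun X P) (hind₂ : iIndepFun Y P) {m n : ℕ → ℕ}
    (hm : Tendsto m atTop atTop) (hn : Tendsto n atTop atTop) :
    ∀ᵐ ω ∂P, Tendsto
      (fun k => (pooledCov (fun l : Fin (m k) => X l ω) (fun l : Fin (n k) => Y l ω)).det) atTop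
      (𝓝 S.det) := by
  filter_upwards [ae_tendsto_pooledCov hν₁ hν₂ hlaw₁ hlaw₂ hind₁ hind₂ hm hn] with ω h
  have hc : Continuous fun M : Fin p → Fin p → ℝ => (Matrix.of M).det :=
    Continuous.matrix_det (A := fun M : Fin p → Fin p → ℝ => Matrix.of M) continuous_id
  exact (hc.tendsto _).comp h

lemma tendsto_measure_isUnit_pooledCov (hS : S.PosDef) (hν₁ : HasMeanCov ν₁ μ S)
    (hν₂ : HasMeanCov ν₂ μ S) (hlaw₁ : ∀ k, HasLaw (X k) ν₁ P) (hlaw₂ : ∀ k, HasLaw (Y k) ν₂ P)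
    (hind₁ : iIndepFun X P) (hind₂ : iIndepFun Y P) {m n : ℕ → ℕ}
    (hm : Tendsto m atTop atTop) (hn : Tendsto n atTop atTop) :
    Tendsto (fun k => P {ω | IsUnit (pooledCov (fun l : Fin (m k) => X l ω)
      (fun l : Fin (n k) => Y l ω))}) atTop (𝓝 1) := by
  have hc : Continuous fun M : Fin p → Fin p → ℝ => (Matrix.of M).det :=
    Continuous.matrix_det (A := fun M : Fin p → Fin p → ℝ => Matrix.of M) continuous_id
  have hmeas := tendstoInMeasure_of_tendsto_ae
    (fun k => (hc.measurable.comp_aemeasurable (aemeasurable_pooledCov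
      (fun l => (hlaw₁ l).aemeasurable) (fun l => (hlaw₂ l).aemeasurable)
      (m k) (n k))).aestronglyMeasurable)
    (ae_tendsto_det_pooledCov hν₁ hν₂ hlaw₁ hlaw₂ hind₁ hind₂ hm hn)
  have hdet := hS.det_pos
  have h0 := (tendstoInMeasure_iff_norm.1 hmeas) S.det hdet
  have h1 : Tendsto (fun k => 1 - P {ω | S.det ≤ ‖(pooledCov (fun l : Fin (m k) => X l ω)
      (fun l : Fin (n k) => Y l ω)).det - S.det‖}) atTop (𝓝 (1 - 0)) :=
    ENNReal.Tendsto.sub tendsto_const_nhds h0 (by simp)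
  rw [tsub_zero] at h1
  refine tendsto_of_tendsto_of_tendsto_of_le_of_le h1 tendsto_const_nhds (fun k => ?_)
    fun k => prob_le_one
  -- A zero determinant deviates from `S.det` by exactly `S.det`, so the deviation event and the
  -- invertibility event cover the space.
  refine tsub_le_iff_left.2 ?_
  rw [← measure_univ (μ := P)]
  refine (measure_mono fun ω _ => ?_).trans (measure_union_le _ _)
  by_cases h : (pooledCov (fun l : Fin (m k) => X l ω) (fun l : Fin (n k) => Y l ω)).det = 0
  · left
    simp [h, abs_of_pos hdet]
  · right
    exact (Matrix.isUnit_iff_isUnit_det _).2 (isUnit_iff_ne_zero.2 h)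

lemma tendstoInDistribution_mul_mahalanobisDist_sq (hS : S.PosDef) (hν₁ : HasMeanCov ν₁ μ S)
    (hν₂ : HasMeanCov ν₂ μ S) (hlaw₁ : ∀ k, HasLaw (X k) ν₁ P) (hlaw₂ : ∀ k, HasLaw (Y k) ν₂ P)
    (hind₁ : iIndepFun X P) (hind₂ : iIndepFun Y P)
    (hind : IndepFun (fun ω k => X k ω) (fun ω k => Y k ω) P) {m n : ℕ → ℕ}
    (hm : Tendsto m atTop atTop) (hn : Tendsto n atTop atTop) {a : ℝ}
    (ha : Tendsto (fun k => √((n k : ℝ) / ((m k : ℝ) + n k))) atTop (𝓝 a)) :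
    TendstoInDistribution
      (fun k ω => ((m k : ℝ) * n k / ((m k : ℝ) + n k)) *
        mahalanobisDist (fun l : Fin (m k) => X l ω) (fun l : Fin (n k) => Y l ω) ^ 2)
      atTop id (fun _ => P) (chiSquared p) := by
  have hX := fun l => (hlaw₁ l).aemeasurable
  have hY := fun l => (hlaw₂ l).aemeasurable
  have hdet : 0 < S.det := hS.det_pos
  have hc : 0 < S.det / 2 := half_pos hdet
  have hcov := ae_tendsto_pooledCov hν₁ hν₂ hlaw₁ hlaw₂ hind₁ hind₂ hm hn
  have hquad := TendstoInDistribution.continuous_comp_prodMk_of_tendstoInMeasure_const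
    (continuous_truncatedQuadForm hc)
    (tendstoInDistribution_scaledMeanDiff hS.posSemidef hν₁ hν₂ hlaw₁ hlaw₂ hind₁ hind₂ hind hm hn
      ha)
    (tendstoInMeasure_of_tendsto_ae
      (fun k => (aemeasurable_pooledCov hX hY (m k) (n k)).aestronglyMeasurable) hcov)
    (fun k => aemeasurable_pooledCov hX hY (m k) (n k))
  have hmeas := fun k => aemeasurable_mul_mahalanobisDist_sq hX hY (m k) (n k)
  -- Almost surely the determinant eventually exceeds `S.det / 2`, where the truncated and true
  -- statistics agree; their difference thus tends to 0.
  have h := tendstoInDistribution_of_tendstoInMeasure_sub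
    (fun k ω => ((m k : ℝ) * n k / ((m k : ℝ) + n k)) *
        mahalanobisDist (fun l : Fin (m k) => X l ω) (fun l : Fin (n k) => Y l ω) ^ 2)
    _ hquad ?_ hmeas
  · refine ⟨hmeas, by fun_prop, ?_⟩
    convert! h.tendsto using 2
    refine congrArg 𝓝 (Subtype.ext ?_)
    refine Measure.map_id.trans ?_
    refine (map_multivariateGaussian_eq_chiSquared hS
      ((continuous_truncatedQuadForm hc).measurable.comp (by fun_prop)) fun z => ?_).symm
    exact truncatedQuadForm_of_le_det (half_le_self hdet.le) z
  · refine tendstoInMeasure_of_tendsto_ae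
      (fun k => ((hmeas k).sub (hquad.forall_aemeasurable k)).aestronglyMeasurable) ?_
    filter_upwards [ae_tendsto_det_pooledCov hν₁ hν₂ hlaw₁ hlaw₂ hind₁ hind₂ hm hn] with ω hω
    refine tendsto_const_nhds.congr' ?_
    filter_upwards [hω.eventually_const_le (half_lt_self hdet)] with k hk
    simp only [Pi.sub_apply, Pi.zero_apply]
    rw [truncatedQuadForm_of_le_det hk, mul_mahalanobisDist_sq, sub_self]

end TwoSamples

theorem theorem1 {Ω : Type*} [MeasurableSpace Ω] (P : Measure Ω) [IsProbabilityMeasure P]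
    (p : ℕ) (μ : Fin p → ℝ) (S : Matrix (Fin p) (Fin p) ℝ) (hS : S.PosDef)
    (ν₁ ν₂ : Measure (Fin p → ℝ)) (hν₁ : HasMeanCov ν₁ μ S) (hν₂ : HasMeanCov ν₂ μ S)
    (X₁ X₂ : ℕ → Ω → Fin p → ℝ)
    (hlaw₁ : ∀ k, HasLaw (X₁ k) ν₁ P) (hlaw₂ : ∀ k, HasLaw (X₂ k) ν₂ P)
    (hind₁ : iIndepFun X₁ P) (hind₂ : iIndepFun X₂ P)
    (hind : IndepFun (fun ω k => X₁ k ω) (fun ω k => X₂ k ω) P) :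
    Tendsto
      (fun n : ℕ × ℕ => P {ω | IsUnit (pooledCov (fun k : Fin n.1 => X₁ k ω)
        (fun k : Fin n.2 => X₂ k ω))})
      (atTop ×ˢ atTop) (𝓝 1) ∧
    TendstoInDistribution
      (fun (n : ℕ × ℕ) (ω : Ω) => ((n.1 : ℝ) * (n.2 : ℝ) / ((n.1 : ℝ) + (n.2 : ℝ))) *
        mahalanobisDist (fun k : Fin n.1 => X₁ k ω) (fun k : Fin n.2 => X₂ k ω) ^ 2)
      (atTop ×ˢ atTop) id (fun _ => P) (chiSquared p) := by
  -- The product filter is countably generated, so sequences of pairs of sample sizes suffice.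
  refine ⟨tendsto_of_seq_tendsto fun s hs => ?_,
    fun n => aemeasurable_mul_mahalanobisDist_sq (fun l => (hlaw₁ l).aemeasurable)
      (fun l => (hlaw₂ l).aemeasurable) n.1 n.2, by fun_prop,
    tendsto_of_subseq_tendsto fun s hs => ?_⟩
  · exact tendsto_measure_isUnit_pooledCov hS hν₁ hν₂ hlaw₁ hlaw₂ hind₁ hind₂
      (tendsto_fst.comp hs) (tendsto_snd.comp hs)
  -- The weights lie in `[0, 1]`, so some subsequence of them converges.
  · have hmem : ∀ k, √(((s k).2 : ℝ) / (((s k).1 : ℝ) + (s k).2)) ∈ Set.Icc (0 : ℝ) 1 := fun k =>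
      ⟨Real.sqrt_nonneg _, Real.sqrt_le_one.2 (div_le_one_of_le₀ (by simp) (by positivity))⟩
    obtain ⟨a, -, φ, hφ, ha⟩ := isCompact_Icc.tendsto_subseq hmem
    have hsφ := hs.comp hφ.tendsto_atTop
    exact ⟨φ, (tendstoInDistribution_mul_mahalanobisDist_sq hS hν₁ hν₂ hlaw₁ hlaw₂ hind₁ hind₂ hind
      (tendsto_fst.comp hsφ) (tendsto_snd.comp hsφ) ha).tendsto⟩
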